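/- Let $F$ be any field and let $F((\mathbb Z))$ be the field of Laurent series over $F$, with its order valuation $v$, residue map $\rho$, the inclusion $\iota$ of the constants as residue field section, and value group section $n\mapsto t^n$. Let $A^-$ be the set of Laurent series with support in $\mathbb Z^{<0}$. For $x\in F((\mathbb Z))$ and $\gamma\in\mathbb Z$ write $x=x'_\gamma+a_\gamma(x)t^\gamma+x''_\gamma$, where $x'_\gamma$ and $x''_\gamma$ are the parts of $x$ with support below and above $\gamma$, and put $h'(x,\gamma)=x'_\gamma$, $g(x,\gamma)=a_\gamma(x)$, $h''(x,\gamma)=x''_\gamma$. Let $c=\sum_{n\ge 0}t^n$. Consider the three-sorted first-order structure $$M=\bigl(F((\mathbb Z)),F,\mathbb Z;\,A^-,+,\cdot,+_{\mathbb Z},\le_{\mathbb Z},+_F,\cdot_F,v,t,\rho,\iota,h',g,h'',c\bigr).$$ Then $M$ has an $\omega$-saturated elementary extension. Moreover, let $$\tilde M=(K,k,G;\,B^-,+_K,\cdot_K,+_G,\le_G,+_k,\cdot_k,\tilde v,\tilde t,\tilde\rho,\tilde\iota,\tilde h',\tilde g,\tilde h'',c)$$ be any $\omega$-saturated elementary extension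 of $M$. Then: 1. $K$ and $k$ are fields, $G$ is an ordered abelian group, $\tilde v$ is a valuation on $K$ with value group $G$, and $\tilde\rho$ is the residue map from its valuation ring $\mathcal O$ onto its residue field $k$; $\tilde\iota$ is a residue field section, and $\tilde t$ is a value group section which is a group homomorphism. 2. $B^-$ is a multiplicative $k$-complement of $\mathcal O$ compatible with $\tilde t$; that is, $B^-$ is a $k$-subspace of $K$ with $K=B^-\oplus\mathcal O$, $B^-\cdot B^-\subseteq B^-$, and $\tilde t^{\gamma}\in B^-$ for all $\gamma<0$ in $G$. 3. For all $x\in K$ and $\gamma\in G$, the decomposition $x=\tilde h'(x,\gamma)+\tilde g(x,\gamma)\,\tilde t^{\gamma}+\tilde h''(x,\gamma)$ is the unique decomposition $x=x'+a\,\tilde t^\gamma+x''$ with $x'\in \tilde t^\gamma B^-$, $a\in k$ and $\tilde v(x'')>\gamma$. 4. $\tilde g(c,\gamma)=1$ for every $\gamma\ge 0$ in $G$; the support $\operatorname{supp}c=\{\gamma\in G:\tilde g(c,\gamma)\ne 0\}$ of $c$ relative to $B^-$ equals $G^{\ge 0}$; and $G^{\ge 0}$ is not well-ordered. 5. $B^-$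 is not a truncation $k$-algebra complement compatible with $\tilde t$. That is, let $f$ be the factor set of $\tilde t$ and let $k((G,f))$ be the field of generalized power series with multiplication determined by $t^\alpha t^\beta=f(\alpha,\beta)t^{\alpha+\beta}$. Then there is no field embedding $\varphi:K\to k((G,f))$ which is the identity on $k$, satisfies $\varphi(\tilde t^\gamma)=t^\gamma$ for all $\gamma\in G$, has image closed under truncation $s\mapsto s_{<\gamma}$ for every $\gamma\in G$, and satisfies $B^-=\varphi^{-1}\bigl(k((G^{<0},f))\bigr)$. -/

import Mathlib

universe u w

/-! ### Valued fields with sections -/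

/-- The valuation ring of an additively written valuation. -/
def valRing {K G : Type*} [Field K] [AddCommGroup G] [LinearOrder G] [IsOrderedAddMonoid G]
    (v : AddValuation K (WithTop G)) : Subring K where
  carrier := {x | 0 ≤ v x}
  mul_mem' {a b} ha hb := by
    simp only [Set.mem_ofPred_eq, AddValuation.map_mul] at *
    exact add_nonneg ha hb
  one_mem' := by simp
  add_mem' {a b} ha hb := le_trans (le_min ha hb) (AddValuation.map_add v a b)
  zero_mem' := by simp
  neg_mem' {a} ha := by simpa using ha

/-- A valued field `K` with value group `G` and residue field `k`, together with a residue field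
section `ι` and a value group section `t`. The residue field is presented by a surjective ring
homomorphism from the valuation ring to `k` whose kernel is the valuation ideal. -/
structure SectionedValuedField (K k G : Type*) [Field K] [Field k] [AddCommGroup G]
    [LinearOrder G] [IsOrderedAddMonoid G] where
  v : AddValuation K (WithTop G)
  v_surjective : Function.Surjective v
  res : valRing v →+* k
  res_surjective : Function.Surjective res
  res_eq_zero_iff : ∀ x : valRing v, res x = 0 ↔ 0 < v (x : K)
  ι : k →+* K
  ι_mem : ∀ a : k, ι a ∈ valRing v
  res_ι : ∀ a : k, res ⟨ι a, ι_mem a⟩ = a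
  t : G → K
  v_t : ∀ γ : G, v (t γ) = (γ : WithTop G)
  t_neg : ∀ γ : G, t (-γ) = (t γ)⁻¹

namespace SectionedValuedField

variable {K k G : Type*} [Field K] [Field k] [AddCommGroup G] [LinearOrder G]
  [IsOrderedAddMonoid G]

/-- `A` is a `k`-complement of the valuation ring: a `k`-subspace of `K` (scalars acting through
`ι`) which is an additive complement of the valuation ring. -/
structure IsComplement (S : SectionedValuedField K k G) (A : Set K) : Prop where
  zero_mem : (0 : K) ∈ A
  add_mem : ∀ x ∈ A, ∀ y ∈ A, x + y ∈ A
  smul_mem : ∀ (a : k), ∀ x ∈ A, S.ι a * x ∈ A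
  disjoint : ∀ x ∈ A, x ∈ valRing S.v → x = 0
  codisjoint : ∀ x : K, ∃ a ∈ A, ∃ o ∈ valRing S.v, x = a + o

/-- `A` is closed under multiplication. -/
def IsMultiplicative (A : Set K) : Prop := ∀ x ∈ A, ∀ y ∈ A, x * y ∈ A

/-- `A` is compatible with the value group section. -/
def IsCompatible (S : SectionedValuedField K k G) (A : Set K) : Prop := ∀ γ : G, γ < 0 → S.t γ ∈ A

/-- `x = x₁ + a t^γ + x₂` with `x₁ ∈ t^γ A`, `a ∈ k` and `v(x₂) > γ`. -/
def IsSplitting (S : SectionedValuedField K k G) (A : Set K) (x : K) (γ : G)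
    (x₁ : K) (a : k) (x₂ : K) : Prop :=
  (∃ y ∈ A, x₁ = S.t γ * y) ∧ (γ : WithTop G) < S.v x₂ ∧ x = x₁ + S.ι a * S.t γ + x₂

/-- The support of `x` relative to `A`: the `γ` for which the coefficient of `t^γ` in the
splitting of `x` at `γ` does not vanish. -/
def supp (S : SectionedValuedField K k G) (A : Set K) (x : K) : Set G :=
  {γ | ∃ (x₁ : K) (a : k) (x₂ : K), S.IsSplitting A x γ x₁ a x₂ ∧ a ≠ 0}

/-- `f` is the factor set of the value group section: `t^α t^β = f(α, β) t^(α + β)`. -/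
def IsFactorSet (S : SectionedValuedField K k G) (f : G → G → k) : Prop :=
  ∀ α β : G, S.t α * S.t β = S.ι (f α β) * S.t (α + β)

/-- The coefficient at `γ` of the product of two power series in `k((G, f))`, where the monomials
are multiplied by the rule `t^α t^β = f(α, β) t^(α + β)`. -/
noncomputable def twistedMulCoeff (f : G → G → k) (x y : HahnSeries G k) (γ : G) : k :=
  ∑ ij ∈ Finset.antidiagonal x.isPWO_support y.isPWO_support γ,
    f ij.1 ij.2 * x.coeff ij.1 * y.coeff ij.2

/-- `φ` is a truncation closed embedding of the field `K` in `k((G, f))` which is the identity on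
the residue field and on the monomials `t^γ`. (It is not required that `φ` preserve the valuation;
this makes the absence of such embeddings a stronger assertion.) -/
structure IsTruncationClosedEmbedding (S : SectionedValuedField K k G) (f : G → G → k)
    (φ : K → HahnSeries G k) : Prop where
  injective : Function.Injective φ
  map_add : ∀ x y, φ (x + y) = φ x + φ y
  map_mul : ∀ x y γ, (φ (x * y)).coeff γ = twistedMulCoeff f (φ x) (φ y) γ
  map_ι : ∀ a, φ (S.ι a) = HahnSeries.single 0 a
  map_t : ∀ γ, φ (S.t γ) = HahnSeries.single γ 1
  truncation_closed : ∀ x γ, ∃ y, φ y = HahnSeries.truncLT γ (φ x)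

/-- `A` is a truncation `k`-algebra complement compatible with `t`: the preimage of
`k((G^{<0}, f))` under a truncation closed embedding of `K` in `k((G, f))`, where `f` is the
factor set of `t`. -/
def IsTruncationComplement (S : SectionedValuedField K k G) (A : Set K) : Prop :=
  ∃ f : G → G → k, S.IsFactorSet f ∧ ∃ φ : K → HahnSeries G k,
    S.IsTruncationClosedEmbedding f φ ∧ A = {x | ∀ γ ∈ (φ x).support, γ < 0}

end SectionedValuedField

/-! ### Three-sorted first-order structures -/

/-- The three sorts: the field, its residue field and its value group. -/
inductive Srt : Type
  | K | k | G
  deriving DecidableEq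

/-- Three-sorted structures
`(K, k, G; B, +_K, ·_K, +_G, ≤_G, +_k, ·_k, v, t, ρ, ι, h', g, h'', c)`
of raw sets and maps, without any axioms. The maps `v` and `ρ`, which in a valued field are only
defined on `K \ {0}` and on the valuation ring, are total here. -/
structure VStruct where
  carrier : Srt → Type u
  B : Set (carrier .K)
  addK : carrier .K → carrier .K → carrier .K
  mulK : carrier .K → carrier .K → carrier .K
  addG : carrier .G → carrier .G → carrier .G
  leG : carrier .G → carrier .G → Prop
  addk : carrier .k → carrier .k → carrier .k
  mulk : carrier .k → carrier .k → carrier .k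
  v : carrier .K → carrier .G
  t : carrier .G → carrier .K
  rho : carrier .K → carrier .k
  iota : carrier .k → carrier .K
  h₁ : carrier .K → carrier .G → carrier .K
  g : carrier .K → carrier .G → carrier .k
  h₂ : carrier .K → carrier .G → carrier .K
  c : carrier .K

/-- Terms of each sort; `var s n` is the `n`-th variable of sort `s`. -/
inductive Term : Srt → Type
  | var (s : Srt) (n : ℕ) : Term s
  | addK (x y : Term .K) : Term .K
  | mulK (x y : Term .K) : Term .K
  | addG (x y : Term .G) : Term .G
  | addk (x y : Term .k) : Term .k
  | mulk (x y : Term .k) : Term .k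
  | v (x : Term .K) : Term .G
  | t (x : Term .G) : Term .K
  | rho (x : Term .K) : Term .k
  | iota (x : Term .k) : Term .K
  | h₁ (x : Term .K) (y : Term .G) : Term .K
  | g (x : Term .K) (y : Term .G) : Term .k
  | h₂ (x : Term .K) (y : Term .G) : Term .K
  | c : Term .K

/-- First-order formulas. The remaining connectives and the existential quantifiers are
expressible through `fls`, `imp` and `all`. -/
inductive Fml : Type
  | eq {s : Srt} (x y : Term s) : Fml
  | leG (x y : Term .G) : Fml
  | memB (x : Term .K) : Fml
  | fls : Fml
  | imp (φ ψ : Fml) : Fml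
  | all (s : Srt) (n : ℕ) (φ : Fml) : Fml

namespace VStruct

/-- Assignments of elements to the variables. -/
abbrev Assignment (M : VStruct.{u}) : Type u := (s : Srt) → ℕ → M.carrier s

/-- The assignment that agrees with `a`, except that the `n`-th variable of sort `s` is `x`. -/
def Assignment.set {M : VStruct.{u}} (a : M.Assignment) (s : Srt) (n : ℕ) (x : M.carrier s) :
    M.Assignment :=
  Function.update a s (Function.update (a s) n x)

/-- The value of a term. -/
def eval (M : VStruct.{u}) (a : M.Assignment) : {s : Srt} → Term s → M.carrier s
  | _, .var s n => a s n
  | _, .addK x y => M.addK (M.eval a x) (M.eval a y)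
  | _, .mulK x y => M.mulK (M.eval a x) (M.eval a y)
  | _, .addG x y => M.addG (M.eval a x) (M.eval a y)
  | _, .addk x y => M.addk (M.eval a x) (M.eval a y)
  | _, .mulk x y => M.mulk (M.eval a x) (M.eval a y)
  | _, .v x => M.v (M.eval a x)
  | _, .t x => M.t (M.eval a x)
  | _, .rho x => M.rho (M.eval a x)
  | _, .iota x => M.iota (M.eval a x)
  | _, .h₁ x y => M.h₁ (M.eval a x) (M.eval a y)
  | _, .g x y => M.g (M.eval a x) (M.eval a y)
  | _, .h₂ x y => M.h₂ (M.eval a x) (M.eval a y)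
  | _, .c => M.c

/-- `M ⊨ φ[a]`. -/
def Sat (M : VStruct.{u}) : M.Assignment → Fml → Prop
  | a, .eq x y => M.eval a x = M.eval a y
  | a, .leG x y => M.leG (M.eval a x) (M.eval a y)
  | a, .memB x => M.eval a x ∈ M.B
  | _, .fls => False
  | a, .imp φ ψ => M.Sat a φ → M.Sat a ψ
  | a, .all s n φ => ∀ x : M.carrier s, M.Sat (a.set s n x) φ

/-- `N` is (up to identification of `M` with its image) an elementary extension of `M`. -/
def IsElementaryExtension (M : VStruct.{u}) (N : VStruct.{w}) : Prop :=
  ∃ e : (s : Srt) → M.carrier s → N.carrier s,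
    ∀ (φ : Fml) (a : M.Assignment), N.Sat (fun s n => e s (a s n)) φ ↔ M.Sat a φ

/-- `M` is `ω`-saturated: every set `Φ` of formulas in one variable (of any sort), with parameters
from a finite subset of `M`, which is finitely satisfiable in `M` is satisfied by an element of `M`.
The parameters are the values of the assignment `a`. -/
def IsOmegaSaturated (M : VStruct.{u}) : Prop :=
  ∀ (a : M.Assignment), (∀ s, (Set.range (a s)).Finite) →
    ∀ (s : Srt) (n : ℕ) (Φ : Set Fml),
      (∀ Φ₀ : Finset Fml, (Φ₀ : Set Fml) ⊆ Φ → ∃ x, ∀ φ ∈ Φ₀, M.Sat (a.set s n x) φ) →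
      ∃ x, ∀ φ ∈ Φ, M.Sat (a.set s n x) φ

/-- The algebraic structure of the valued field with sections `S` is the one given by the
operations of `N`. -/
structure Presents (N : VStruct.{u}) [Field (N.carrier .K)] [Field (N.carrier .k)]
    [AddCommGroup (N.carrier .G)] [LinearOrder (N.carrier .G)] [IsOrderedAddMonoid (N.carrier .G)]
    (S : SectionedValuedField (N.carrier .K) (N.carrier .k) (N.carrier .G)) : Prop where
  addK : ∀ x y, N.addK x y = x + y
  mulK : ∀ x y, N.mulK x y = x * y
  addG : ∀ α β, N.addG α β = α + β
  leG : ∀ α β, N.leG α β ↔ α ≤ β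
  addk : ∀ a b, N.addk a b = a + b
  mulk : ∀ a b, N.mulk a b = a * b
  v : ∀ x, x ≠ 0 → S.v x = (N.v x : WithTop (N.carrier .G))
  t : ∀ γ, N.t γ = S.t γ
  rho : ∀ x : valRing S.v, N.rho x = S.res x
  iota : ∀ a, N.iota a = S.ι a

end VStruct

/-- The structure `M` on the field `F((ℤ))` of Laurent series over `F`: `B` consists of the series
with support in `ℤ^{<0}`, `v` is the order (with `v 0 = 0`), `t n = t^n`, `ρ` is the residue map
(extended by `0` outside the valuation ring), `ι` is the inclusion of the constants, `h₁ x γ`,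
`g x γ` and `h₂ x γ` are the part of `x` below `γ`, the coefficient of `x` at `γ` and the part of
`x` above `γ`, and `c = ∑_{n ≥ 0} t^n`. -/
noncomputable def laurentStruct (F : Type u) [Field F] : VStruct.{u} where
  carrier
    | .K => HahnSeries ℤ F
    | .k => F
    | .G => ULift.{u} ℤ
  B := {x : HahnSeries ℤ F | ∀ n ∈ x.support, n < 0}
  addK := fun x y : HahnSeries ℤ F => x + y
  mulK := fun x y : HahnSeries ℤ F => x * y
  addG := fun α β : ULift.{u} ℤ => ⟨α.down + β.down⟩
  leG := fun α β : ULift.{u} ℤ => α.down ≤ β.down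
  addk := fun a b : F => a + b
  mulk := fun a b : F => a * b
  v := fun x : HahnSeries ℤ F => (⟨x.order⟩ : ULift.{u} ℤ)
  t := fun γ : ULift.{u} ℤ => HahnSeries.single γ.down (1 : F)
  rho := fun x : HahnSeries ℤ F => if 0 ≤ x.order then x.coeff 0 else 0
  iota := fun a : F => (HahnSeries.C a : HahnSeries ℤ F)
  h₁ := fun (x : HahnSeries ℤ F) (γ : ULift.{u} ℤ) => HahnSeries.truncLT γ.down x
  g := fun (x : HahnSeries ℤ F) (γ : ULift.{u} ℤ) => x.coeff γ.down
  h₂ := fun (x : HahnSeries ℤ F) (γ : ULift.{u} ℤ) => x - HahnSeries.truncLT (γ.down + 1) x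
  c := HahnSeries.ofPowerSeries ℤ F (PowerSeries.mk fun _ => (1 : F))

/-! Existence of a saturated extension: the language is countable, so the ultrapower of `M` by a
nonprincipal ultrafilter on `ℕ` is an elementary extension by Łoś's theorem (`sat_germAssignment`)
and realises every finitely satisfiable type by a diagonal choice (`isOmegaSaturated_ultrapower`).

For an arbitrary saturated extension, the positive assertions rest on finitely many first-order laws
(`VStruct.Laws`). These hold for Laurent series (`laurentStruct_laws`), pass to the extension
(`Laws.transfer`), and allow the fields, the ordered group and the valuation to be rebuilt on its
sorts. Uniqueness of the decomposition at `γ` then follows by comparing valuations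
(`IsSplitting.unique`).

The negative assertions come from an element `γ` of `G` above every `n • 1`, which saturation
supplies. The sequence `γ - n • 1` descends forever in `G^{≥0}`. Moreover, the law `h₁_c` says that
the part of `c` below `γ` is the finite geometric sum `(1 - t^γ) / (1 - t)`, even for infinite `γ`.
Multiplied by `t^(-γ)` it becomes an element `y` of `B^-` with `y + 1 = y t + t^(-γ)`. If `B^-` came
from a truncation closed embedding, the image of `y` would have only negative exponents. Reading the
equation at exponents `0, -1, -2, …`, none of which reaches `-γ`, would make all its coefficients at
`-1, -2, …` equal to `1`, so its support would not be well-ordered (`not_isTruncationComplement`).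
-/

/-! ### Countability of the language -/

/-- A code for the sort `s`. -/
def Srt.code : Srt → ℕ
  | .K => 0
  | .k => 1
  | .G => 2

theorem Srt.code_injective : Function.Injective Srt.code := by
  intro s s' h
  cases s <;> cases s' <;> simp_all [Srt.code]

namespace Term

/-- A code for a term. -/
def code : {s : Srt} → Term s → ℕ
  | _, .var _ n => Nat.pair 0 n
  | _, .addK x y => Nat.pair 1 (Nat.pair x.code y.code)
  | _, .mulK x y => Nat.pair 2 (Nat.pair x.code y.code)
  | _, .addG x y => Nat.pair 3 (Nat.pair x.code y.code)
  | _, .addk x y => Nat.pair 4 (Nat.pair x.code y.code)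
  | _, .mulk x y => Nat.pair 5 (Nat.pair x.code y.code)
  | _, .v x => Nat.pair 6 x.code
  | _, .t x => Nat.pair 7 x.code
  | _, .rho x => Nat.pair 8 x.code
  | _, .iota x => Nat.pair 9 x.code
  | _, .h₁ x y => Nat.pair 10 (Nat.pair x.code y.code)
  | _, .g x y => Nat.pair 11 (Nat.pair x.code y.code)
  | _, .h₂ x y => Nat.pair 12 (Nat.pair x.code y.code)
  | _, .c => Nat.pair 13 0

/-- Both terms have the same sort by their types, so the code of a variable need not record its
sort. An equation does not reveal the sort of its sides in this way, which is why `Fml.code` stores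
it. -/
theorem code_inj {s : Srt} (x : Term s) : ∀ y : Term s, x.code = y.code → x = y := by
  induction x with
  | var s n => intro y h; cases y <;> simp_all [code, Nat.pair_eq_pair]
  | addK _ _ h₁ h₂ | mulK _ _ h₁ h₂ | addG _ _ h₁ h₂ | addk _ _ h₁ h₂ | mulk _ _ h₁ h₂
  | h₁ _ _ h₁ h₂ | g _ _ h₁ h₂ | h₂ _ _ h₁ h₂ =>
    intro y h
    cases y <;> simp only [code, Nat.pair_eq_pair] at h <;> first
      | exact absurd h.1 (by decide)
      | rw [h₁ _ h.2.1, h₂ _ h.2.2]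
  | v _ ih | t _ ih | rho _ ih | iota _ ih =>
    intro y h
    cases y <;> simp only [code, Nat.pair_eq_pair] at h <;> first
      | exact absurd h.1 (by decide)
      | rw [ih _ h.2]
  | c => intro y h; cases y <;> simp_all [code, Nat.pair_eq_pair]

end Term

namespace Fml

/-- A code for a formula. -/
def code : Fml → ℕ
  | .eq (s := s) x y => Nat.pair 0 (Nat.pair s.code (Nat.pair x.code y.code))
  | .leG x y => Nat.pair 1 (Nat.pair x.code y.code)
  | .memB x => Nat.pair 2 x.code
  | .fls => Nat.pair 3 0
  | .imp φ ψ => Nat.pair 4 (Nat.pair φ.code ψ.code)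
  | .all s n φ => Nat.pair 5 (Nat.pair s.code (Nat.pair n φ.code))

theorem code_injective : Function.Injective code := by
  intro φ
  induction φ with
  | @eq s x y =>
    rintro (@⟨s', x', y'⟩ | _) h <;> simp only [code, Nat.pair_eq_pair] at h <;> first
      | exact absurd h.1 (by decide)
      | obtain ⟨-, hs, hx, hy⟩ := h
        obtain rfl := Srt.code_injective hs
        rw [Term.code_inj _ _ hx, Term.code_inj _ _ hy]
  | leG x y =>
    rintro (_ | _) h <;> simp only [code, Nat.pair_eq_pair] at h <;> first
      | exact absurd h.1 (by decide)
      | rw [Term.code_inj _ _ h.2.1, Term.code_inj _ _ h.2.2]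
  | memB x =>
    rintro (_ | _) h <;> simp only [code, Nat.pair_eq_pair] at h <;> first
      | exact absurd h.1 (by decide)
      | rw [Term.code_inj _ _ h.2]
  | fls => rintro (_ | _) h <;> simp_all [code, Nat.pair_eq_pair]
  | imp φ ψ h₁ h₂ =>
    rintro (_ | _) h <;> simp only [code, Nat.pair_eq_pair] at h <;> first
      | exact absurd h.1 (by decide)
      | rw [h₁ h.2.1, h₂ h.2.2]
  | all s n φ ih =>
    rintro (_ | _) h <;> simp only [code, Nat.pair_eq_pair] at h <;> first
      | exact absurd h.1 (by decide)
      | rw [Srt.code_injective h.2.1, h.2.2.1, ih h.2.2.2]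

instance : Countable Fml := code_injective.countable

end Fml

/-! ### Ultrapowers -/

namespace VStruct

open Filter

theorem Assignment.set_self {M : VStruct.{u}} (a : M.Assignment) (s : Srt) (n : ℕ)
    (x : M.carrier s) : a.set s n x s n = x := by
  simp [Assignment.set]

theorem Assignment.set_of_ne {M : VStruct.{u}} (a : M.Assignment) {s : Srt} {n m : ℕ}
    (h : m ≠ n) (x : M.carrier s) : a.set s n x s m = a s m := by
  simp [Assignment.set, h]

theorem Assignment.set_of_sort_ne {M : VStruct.{u}} (a : M.Assignment) {s s' : Srt} {n m : ℕ}
    (h : s' ≠ s) (x : M.carrier s) : a.set s n x s' m = a s' m := by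
  simp [Assignment.set, h]

/-- The ultrapower of `M` by an ultrafilter on the natural numbers. -/
noncomputable def ultrapower (M : VStruct.{u}) (U : Ultrafilter ℕ) : VStruct.{u} where
  carrier s := Germ (U : Filter ℕ) (M.carrier s)
  B := {x | Germ.LiftPred (· ∈ M.B) x}
  addK := Germ.map₂ M.addK
  mulK := Germ.map₂ M.mulK
  addG := Germ.map₂ M.addG
  leG := Germ.LiftRel M.leG
  addk := Germ.map₂ M.addk
  mulk := Germ.map₂ M.mulk
  v := Germ.map M.v
  t := Germ.map M.t
  rho := Germ.map M.rho
  iota := Germ.map M.iota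
  h₁ := Germ.map₂ M.h₁
  g := Germ.map₂ M.g
  h₂ := Germ.map₂ M.h₂
  c := ((fun _ => M.c : ℕ → M.carrier .K) : Germ (U : Filter ℕ) (M.carrier .K))

/-- The class of a sequence of assignments. -/
def germAssignment {M : VStruct.{u}} (U : Ultrafilter ℕ) (α : ℕ → M.Assignment) :
    (M.ultrapower U).Assignment :=
  fun s n => ((fun i => α i s n : ℕ → M.carrier s) : Germ (U : Filter ℕ) (M.carrier s))

/-- Representatives can be chosen for each variable separately, so Łoś's theorem for sequences of
assignments covers all assignments in the ultrapower. -/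
theorem exists_germAssignment_eq {M : VStruct.{u}} (U : Ultrafilter ℕ)
    (a : (M.ultrapower U).Assignment) : ∃ α : ℕ → M.Assignment, germAssignment U α = a := by
  have h : ∀ s n, ∃ f : ℕ → M.carrier s, (f : Germ (U : Filter ℕ) (M.carrier s)) = a s n :=
    fun s n => Quot.exists_rep (a s n)
  choose f hf using h
  exact ⟨fun i s n => f s n i, funext fun s => funext fun n => hf s n⟩

theorem germAssignment_set {M : VStruct.{u}} (U : Ultrafilter ℕ) (α : ℕ → M.Assignment)
    (s : Srt) (n : ℕ) (x : ℕ → M.carrier s) :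
    (germAssignment U α).set s n (x : Germ (U : Filter ℕ) (M.carrier s)) =
      germAssignment U fun i => (α i).set s n (x i) := by
  funext s' m
  by_cases hs : s' = s
  · subst hs
    by_cases hm : m = n
    · subst hm
      refine (Assignment.set_self _ _ _ _).trans ?_
      simp only [germAssignment, Assignment.set_self]
      rfl
    · refine (Assignment.set_of_ne _ hm _).trans ?_
      simp only [germAssignment, Assignment.set_of_ne _ hm]
      rfl
  · refine (Assignment.set_of_sort_ne _ hs _).trans ?_
    simp only [germAssignment, Assignment.set_of_sort_ne _ hs]
    rfl

theorem eval_germAssignment {M : VStruct.{u}} (U : Ultrafilter ℕ) (α : ℕ → M.Assignment)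
    {s : Srt} (x : Term s) :
    (M.ultrapower U).eval (germAssignment U α) x =
      ((fun i => M.eval (α i) x : ℕ → M.carrier s) : Germ (U : Filter ℕ) (M.carrier s)) := by
  induction x with
  | var s n => rfl
  | c => rfl
  | addK _ _ h₁ h₂ | mulK _ _ h₁ h₂ | addG _ _ h₁ h₂ | addk _ _ h₁ h₂ | mulk _ _ h₁ h₂
  | h₁ _ _ h₁ h₂ | g _ _ h₁ h₂ | h₂ _ _ h₁ h₂ =>
    rw [eval, h₁, h₂]
    rfl
  | v _ ih | t _ ih | rho _ ih | iota _ ih =>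
    rw [eval, ih]
    rfl

/-- Łoś's theorem. -/
theorem sat_germAssignment {M : VStruct.{u}} (U : Ultrafilter ℕ) (φ : Fml) :
    ∀ α : ℕ → M.Assignment,
      (M.ultrapower U).Sat (germAssignment U α) φ ↔ ∀ᶠ i in (U : Filter ℕ), M.Sat (α i) φ := by
  induction φ with
  | eq x y =>
    intro α
    rw [Sat, eval_germAssignment, eval_germAssignment]
    exact Germ.coe_eq
  | leG x y =>
    intro α
    rw [Sat, eval_germAssignment, eval_germAssignment]
    exact Germ.liftRel_coe
  | memB x =>
    intro α
    rw [Sat, eval_germAssignment]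
    exact Germ.liftPred_coe
  | fls => simp [Sat, U.neBot.ne]
  | imp φ ψ h₁ h₂ =>
    intro α
    simp only [Sat, h₁, h₂, Ultrafilter.eventually_imp]
  | all s n φ ih =>
    intro α
    simp only [Sat]
    constructor
    · intro h
      by_contra hα
      rw [← Ultrafilter.eventually_not] at hα
      -- Choose a counterexample at every index that has one; the germ of these choices refutes the
      -- universal statement in the ultrapower. At other indices any element will do, and the
      -- assignment provides one.
      have hx : ∀ i, ∃ x : M.carrier s,
          (¬ ∀ x, M.Sat ((α i).set s n x) φ) → ¬ M.Sat ((α i).set s n x) φ := by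
        intro i
        by_cases hi : ∀ x, M.Sat ((α i).set s n x) φ
        · exact ⟨α i s n, fun h => absurd hi h⟩
        · obtain ⟨x, hx⟩ := not_forall.1 hi
          exact ⟨x, fun _ => hx⟩
      choose x hx using hx
      have := h (x : Germ (U : Filter ℕ) (M.carrier s))
      rw [germAssignment_set, ih] at this
      obtain ⟨i, h₁, h₂⟩ := (hα.and this).exists
      exact hx i h₁ h₂
    · intro h x
      induction x using Germ.inductionOn with
      | h x =>
        rw [germAssignment_set, ih]
        exact h.mono fun i hi => hi (x i)

theorem isElementaryExtension_ultrapower (M : VStruct.{u}) (U : Ultrafilter ℕ) :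
    M.IsElementaryExtension (M.ultrapower U) := by
  refine ⟨fun s x => ((fun _ => x : ℕ → M.carrier s) : Germ (U : Filter ℕ) (M.carrier s)),
    fun φ a => ?_⟩
  exact (sat_germAssignment U φ fun _ => a).trans eventually_const

/-- Enumerate the type as `φ 0, φ 1, …`. At index `i` choose an element satisfying the longest
initial segment `φ 0, …, φ m` with `m ≤ i` that can be satisfied there. A given `φ j` then holds at
almost every index: its initial segment is satisfiable at almost every `i` by Łoś's theorem, and `j
≤ i` for almost all `i` because the ultrafilter is nonprincipal. -/
theorem isOmegaSaturated_ultrapower (M : VStruct.{u}) :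
    (M.ultrapower (hyperfilter ℕ)).IsOmegaSaturated := by
  classical
  intro a _ s n Φ hΦ
  obtain rfl | hne := Φ.eq_empty_or_nonempty
  · exact ⟨a s n, by simp⟩
  obtain ⟨α, rfl⟩ := exists_germAssignment_eq _ a
  obtain ⟨φ, rfl⟩ := (Set.to_countable Φ).exists_eq_range hne
  let P : ℕ → ℕ → Prop := fun i m => ∃ x, ∀ j ≤ m, M.Sat ((α i).set s n x) (φ j)
  have hP : ∀ m, ∀ᶠ i in (hyperfilter ℕ : Filter ℕ), P i m := by
    intro m
    obtain ⟨x, hx⟩ := hΦ ((Finset.range (m + 1)).image φ) (by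
      intro ψ hψ
      obtain ⟨j, -, rfl⟩ := Finset.mem_image.1 hψ
      exact ⟨j, rfl⟩)
    induction x using Germ.inductionOn with
    | h x =>
      have : ∀ᶠ i in (hyperfilter ℕ : Filter ℕ), ∀ j ∈ Finset.range (m + 1),
          M.Sat ((α i).set s n (x i)) (φ j) := by
        rw [eventually_all_finset]
        intro j hj
        have := hx (φ j) (Finset.mem_image_of_mem φ hj)
        rwa [germAssignment_set, sat_germAssignment] at this
      exact this.mono fun i hi => ⟨x i, fun j hj => hi j (by simpa [Nat.lt_succ_iff] using hj)⟩
  -- The premise guards against `Nat.findGreatest` returning its default `0` when not even `φ 0` is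
  -- satisfiable at `i`.
  have hx : ∀ i, ∃ x, P i (Nat.findGreatest (P i) i) →
      ∀ j ≤ Nat.findGreatest (P i) i, M.Sat ((α i).set s n x) (φ j) := by
    intro i
    by_cases h : P i (Nat.findGreatest (P i) i)
    · exact h.imp fun x hx _ => hx
    · exact ⟨α i s n, fun h' => absurd h' h⟩
  choose x hx using hx
  refine ⟨(x : Germ (hyperfilter ℕ : Filter ℕ) (M.carrier s)), ?_⟩
  rintro _ ⟨j, rfl⟩
  rw [germAssignment_set, sat_germAssignment]
  have hj : ∀ᶠ i in (hyperfilter ℕ : Filter ℕ), j ≤ i :=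
    Nat.hyperfilter_le_atTop (eventually_ge_atTop j)
  filter_upwards [hP j, hj] with i h₁ h₂
  exact hx i (Nat.findGreatest_spec h₂ h₁) j (Nat.le_findGreatest h₂ h₁)

end VStruct

/-! ### First-order properties of the Laurent series field -/

namespace Fml

/-- Negation. -/
abbrev not (φ : Fml) : Fml := .imp φ .fls

/-- The existential quantifier. -/
abbrev ex (s : Srt) (n : ℕ) (φ : Fml) : Fml := .not (.all s n (.not φ))

end Fml

namespace VStruct

/-- First-order properties of the field of Laurent series. The constants `0`, `1`, `-1` of the
fields and `0`, `1` of the value group are the values of the first variables. -/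
structure Laws (N : VStruct.{w}) (c : N.Assignment) : Prop where
  addK_assoc : ∀ x y z, N.addK (N.addK x y) z = N.addK x (N.addK y z)
  zero_addK : ∀ x, N.addK (c .K 0) x = x
  neg_addK : ∀ x, N.addK (N.mulK (c .K 2) x) x = c .K 0
  mulK_assoc : ∀ x y z, N.mulK (N.mulK x y) z = N.mulK x (N.mulK y z)
  mulK_comm : ∀ x y, N.mulK x y = N.mulK y x
  one_mulK : ∀ x, N.mulK (c .K 1) x = x
  mulK_addK : ∀ x y z, N.mulK x (N.addK y z) = N.addK (N.mulK x y) (N.mulK x z)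
  invK : ∀ x, x ≠ c .K 0 → ∃ y, N.mulK x y = c .K 1
  zero_ne_oneK : c .K 0 ≠ c .K 1
  addk_assoc : ∀ x y z, N.addk (N.addk x y) z = N.addk x (N.addk y z)
  zero_addk : ∀ x, N.addk (c .k 0) x = x
  neg_addk : ∀ x, N.addk (N.mulk (c .k 2) x) x = c .k 0
  mulk_assoc : ∀ x y z, N.mulk (N.mulk x y) z = N.mulk x (N.mulk y z)
  mulk_comm : ∀ x y, N.mulk x y = N.mulk y x
  one_mulk : ∀ x, N.mulk (c .k 1) x = x
  mulk_addk : ∀ x y z, N.mulk x (N.addk y z) = N.addk (N.mulk x y) (N.mulk x z)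
  invk : ∀ x, x ≠ c .k 0 → ∃ y, N.mulk x y = c .k 1
  zero_ne_onek : c .k 0 ≠ c .k 1
  addG_assoc : ∀ x y z, N.addG (N.addG x y) z = N.addG x (N.addG y z)
  zero_addG : ∀ x, N.addG (c .G 0) x = x
  addG_comm : ∀ x y, N.addG x y = N.addG y x
  negG : ∀ x, ∃ y, N.addG y x = c .G 0
  le_refl : ∀ x, N.leG x x
  le_trans : ∀ x y z, N.leG x y → N.leG y z → N.leG x z
  le_antisymm : ∀ x y, N.leG x y → N.leG y x → x = y
  le_total : ∀ x y, N.leG x y ∨ N.leG y x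
  add_le_add : ∀ x y z, N.leG x y → N.leG (N.addG x z) (N.addG y z)
  zero_le_one : N.leG (c .G 0) (c .G 1)
  zero_ne_oneG : c .G 0 ≠ c .G 1
  v_zero : N.v (c .K 0) = c .G 0
  v_mul : ∀ x y, x ≠ c .K 0 → y ≠ c .K 0 → N.v (N.mulK x y) = N.addG (N.v x) (N.v y)
  v_add : ∀ x y, x ≠ c .K 0 → y ≠ c .K 0 → N.addK x y ≠ c .K 0 →
    N.leG (N.v x) (N.v (N.addK x y)) ∨ N.leG (N.v y) (N.v (N.addK x y))
  v_t : ∀ γ, N.v (N.t γ) = γ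
  t_ne_zero : ∀ γ, N.t γ ≠ c .K 0
  t_add : ∀ γ δ, N.t (N.addG γ δ) = N.mulK (N.t γ) (N.t δ)
  rho_add : ∀ x y, N.leG (c .G 0) (N.v x) → N.leG (c .G 0) (N.v y) →
    N.rho (N.addK x y) = N.addk (N.rho x) (N.rho y)
  rho_mul : ∀ x y, N.leG (c .G 0) (N.v x) → N.leG (c .G 0) (N.v y) →
    N.rho (N.mulK x y) = N.mulk (N.rho x) (N.rho y)
  rho_one : N.rho (c .K 1) = c .k 1
  rho_zero : N.rho (c .K 0) = c .k 0
  rho_eq_zero : ∀ x, x ≠ c .K 0 → N.leG (c .G 0) (N.v x) →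
    (N.rho x = c .k 0 → N.v x ≠ c .G 0)
  rho_of_pos : ∀ x, x ≠ c .K 0 → N.leG (c .G 0) (N.v x) → N.v x ≠ c .G 0 → N.rho x = c .k 0
  iota_add : ∀ x y, N.iota (N.addk x y) = N.addK (N.iota x) (N.iota y)
  iota_mul : ∀ x y, N.iota (N.mulk x y) = N.mulK (N.iota x) (N.iota y)
  iota_one : N.iota (c .k 1) = c .K 1
  iota_zero : N.iota (c .k 0) = c .K 0
  iota_mem : ∀ x, N.leG (c .G 0) (N.v (N.iota x))
  rho_iota : ∀ x, N.rho (N.iota x) = x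
  zero_mem : c .K 0 ∈ N.B
  add_mem : ∀ x y, x ∈ N.B → y ∈ N.B → N.addK x y ∈ N.B
  smul_mem : ∀ a x, x ∈ N.B → N.mulK (N.iota a) x ∈ N.B
  mul_mem : ∀ x y, x ∈ N.B → y ∈ N.B → N.mulK x y ∈ N.B
  disjoint : ∀ x, x ∈ N.B → N.leG (c .G 0) (N.v x) → x = c .K 0
  t_mem : ∀ γ, N.leG γ (c .G 0) → γ ≠ c .G 0 → N.t γ ∈ N.B
  decomposition : ∀ x γ,
    x = N.addK (N.addK (N.h₁ x γ) (N.mulK (N.iota (N.g x γ)) (N.t γ))) (N.h₂ x γ)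
  h₁_mem : ∀ x γ δ, N.addG γ δ = c .G 0 → N.mulK (N.t δ) (N.h₁ x γ) ∈ N.B
  v_h₂ : ∀ x γ, N.h₂ x γ ≠ c .K 0 → N.leG γ (N.v (N.h₂ x γ))
  v_h₂_ne : ∀ x γ, N.h₂ x γ ≠ c .K 0 → N.v (N.h₂ x γ) ≠ γ
  g_c : ∀ γ, N.leG (c .G 0) γ → N.g N.c γ = c .k 1
  g_c_of_neg : ∀ γ, N.leG γ (c .G 0) → γ ≠ c .G 0 → N.g N.c γ = c .k 0
  h₁_c : ∀ γ, N.leG (c .G 0) γ →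
    N.addK (N.h₁ N.c γ) (N.t γ) = N.addK (N.mulK (N.h₁ N.c γ) (N.t (c .G 1))) (c .K 1)

/-! ### Transfer of the laws to elementary extensions -/

section transfer

open Term Fml

/-- Each law is spelled out as a formula in which variables `0`, `1`, `2` name constants and bound
variables start at `3`. Satisfaction unfolds to the law by definition, except that existentials
(coded as `¬ ∀ ¬`) and disjunctions (coded as implications) need classical logic. -/
theorem Laws.transfer {M : VStruct.{u}} {N : VStruct.{w}} {c : M.Assignment}
    {d : N.Assignment} (H : ∀ φ, N.Sat d φ ↔ M.Sat c φ) (h : M.Laws c) : N.Laws d where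
  addK_assoc := (H (all .K 3 (all .K 4 (all .K 5 (eq (.addK (.addK (var .K 3) (var .K 4))
    (var .K 5)) (.addK (var .K 3) (.addK (var .K 4) (var .K 5)))))))).2 h.addK_assoc
  zero_addK := (H (all .K 3 (eq (.addK (var .K 0) (var .K 3)) (var .K 3)))).2 h.zero_addK
  neg_addK := (H (all .K 3 (eq (.addK (.mulK (var .K 2) (var .K 3)) (var .K 3)) (var .K 0)))).2
    h.neg_addK
  mulK_assoc := (H (all .K 3 (all .K 4 (all .K 5 (eq (.mulK (.mulK (var .K 3) (var .K 4))
    (var .K 5)) (.mulK (var .K 3) (.mulK (var .K 4) (var .K 5)))))))).2 h.mulK_assoc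
  mulK_comm := (H (all .K 3 (all .K 4 (eq (.mulK (var .K 3) (var .K 4)) (.mulK (var .K 4)
    (var .K 3)))))).2 h.mulK_comm
  one_mulK := (H (all .K 3 (eq (.mulK (var .K 1) (var .K 3)) (var .K 3)))).2 h.one_mulK
  mulK_addK := (H (all .K 3 (all .K 4 (all .K 5 (eq (.mulK (var .K 3) (.addK (var .K 4) (var .K 5)))
    (.addK (.mulK (var .K 3) (var .K 4)) (.mulK (var .K 3) (var .K 5)))))))).2 h.mulK_addK
  invK := by
    simpa [Sat, eval, Assignment.set] using (H (all .K 3 (imp (not (eq (var .K 3) (var .K 0))) (ex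
      .K 4 (eq (.mulK (var .K 3) (var .K 4)) (var .K 1)))))).2 (by simpa [Sat, eval, Assignment.set]
      using h.invK)
  zero_ne_oneK := (H (not (eq (var .K 0) (var .K 1)))).2 h.zero_ne_oneK
  addk_assoc := (H (all .k 3 (all .k 4 (all .k 5 (eq (.addk (.addk (var .k 3) (var .k 4))
    (var .k 5)) (.addk (var .k 3) (.addk (var .k 4) (var .k 5)))))))).2 h.addk_assoc
  zero_addk := (H (all .k 3 (eq (.addk (var .k 0) (var .k 3)) (var .k 3)))).2 h.zero_addk
  neg_addk := (H (all .k 3 (eq (.addk (.mulk (var .k 2) (var .k 3)) (var .k 3)) (var .k 0)))).2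
    h.neg_addk
  mulk_assoc := (H (all .k 3 (all .k 4 (all .k 5 (eq (.mulk (.mulk (var .k 3) (var .k 4))
    (var .k 5)) (.mulk (var .k 3) (.mulk (var .k 4) (var .k 5)))))))).2 h.mulk_assoc
  mulk_comm := (H (all .k 3 (all .k 4 (eq (.mulk (var .k 3) (var .k 4)) (.mulk (var .k 4)
    (var .k 3)))))).2 h.mulk_comm
  one_mulk := (H (all .k 3 (eq (.mulk (var .k 1) (var .k 3)) (var .k 3)))).2 h.one_mulk
  mulk_addk := (H (all .k 3 (all .k 4 (all .k 5 (eq (.mulk (var .k 3) (.addk (var .k 4) (var .k 5)))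
    (.addk (.mulk (var .k 3) (var .k 4)) (.mulk (var .k 3) (var .k 5)))))))).2 h.mulk_addk
  invk := by
    simpa [Sat, eval, Assignment.set] using (H (all .k 3 (imp (not (eq (var .k 3) (var .k 0))) (ex
      .k 4 (eq (.mulk (var .k 3) (var .k 4)) (var .k 1)))))).2 (by simpa [Sat, eval, Assignment.set]
      using h.invk)
  zero_ne_onek := (H (not (eq (var .k 0) (var .k 1)))).2 h.zero_ne_onek
  addG_assoc := (H (all .G 3 (all .G 4 (all .G 5 (eq (.addG (.addG (var .G 3) (var .G 4))
    (var .G 5)) (.addG (var .G 3) (.addG (var .G 4) (var .G 5)))))))).2 h.addG_assoc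
  zero_addG := (H (all .G 3 (eq (.addG (var .G 0) (var .G 3)) (var .G 3)))).2 h.zero_addG
  addG_comm := (H (all .G 3 (all .G 4 (eq (.addG (var .G 3) (var .G 4)) (.addG (var .G 4)
    (var .G 3)))))).2 h.addG_comm
  negG := by
    simpa [Sat, eval, Assignment.set] using (H (all .G 3 (ex .G 4 (eq (.addG (var .G 4) (var .G 3))
      (var .G 0))))).2 (by simpa [Sat, eval, Assignment.set] using h.negG)
  le_refl := (H (all .G 3 (.leG (var .G 3) (var .G 3)))).2 h.le_refl
  le_trans := (H (all .G 3 (all .G 4 (all .G 5 (imp (.leG (var .G 3) (var .G 4)) (imp (.leG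
    (var .G 4) (var .G 5)) (.leG (var .G 3) (var .G 5)))))))).2 h.le_trans
  le_antisymm := (H (all .G 3 (all .G 4 (imp (.leG (var .G 3) (var .G 4)) (imp (.leG (var .G 4)
    (var .G 3)) (eq (var .G 3) (var .G 4))))))).2 h.le_antisymm
  le_total := fun x y => or_iff_not_imp_left.2 ((H (all .G 3 (all .G 4 (imp (not (.leG (var .G 3)
    (var .G 4))) (.leG (var .G 4) (var .G 3)))))).2 (fun x y => or_iff_not_imp_left.1 (h.le_total x
    y)) x y)
  add_le_add := (H (all .G 3 (all .G 4 (all .G 5 (imp (.leG (var .G 3) (var .G 4)) (.leG (.addG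
    (var .G 3) (var .G 5)) (.addG (var .G 4) (var .G 5)))))))).2 h.add_le_add
  zero_le_one := (H (.leG (var .G 0) (var .G 1))).2 h.zero_le_one
  zero_ne_oneG := (H (not (eq (var .G 0) (var .G 1)))).2 h.zero_ne_oneG
  v_zero := (H (eq (.v (var .K 0)) (var .G 0))).2 h.v_zero
  v_mul := (H (all .K 3 (all .K 4 (imp (not (eq (var .K 3) (var .K 0))) (imp (not (eq (var .K 4)
    (var .K 0))) (eq (.v (.mulK (var .K 3) (var .K 4))) (.addG (.v (var .K 3)) (.v
    (var .K 4))))))))).2 h.v_mul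
  v_add := fun x y hx hy hxy => or_iff_not_imp_left.2 ((H (all .K 3 (all .K 4 (imp (not (eq
    (var .K 3) (var .K 0))) (imp (not (eq (var .K 4) (var .K 0))) (imp (not (eq (.addK (var .K 3)
    (var .K 4)) (var .K 0))) (imp (not (.leG (.v (var .K 3)) (.v (.addK (var .K 3) (var .K 4)))))
    (.leG (.v (var .K 4)) (.v (.addK (var .K 3) (var .K 4))))))))))).2 (fun x y hx hy hxy =>
    or_iff_not_imp_left.1 (h.v_add x y hx hy hxy)) x y hx hy hxy)
  v_t := (H (all .G 3 (eq (.v (.t (var .G 3))) (var .G 3)))).2 h.v_t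
  t_ne_zero := (H (all .G 3 (not (eq (.t (var .G 3)) (var .K 0))))).2 h.t_ne_zero
  t_add := (H (all .G 3 (all .G 4 (eq (.t (.addG (var .G 3) (var .G 4))) (.mulK (.t (var .G 3)) (.t
    (var .G 4))))))).2 h.t_add
  rho_add := (H (all .K 3 (all .K 4 (imp (.leG (var .G 0) (.v (var .K 3))) (imp (.leG (var .G 0) (.v
    (var .K 4))) (eq (.rho (.addK (var .K 3) (var .K 4))) (.addk (.rho (var .K 3)) (.rho
    (var .K 4))))))))).2 h.rho_add
  rho_mul := (H (all .K 3 (all .K 4 (imp (.leG (var .G 0) (.v (var .K 3))) (imp (.leG (var .G 0) (.v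
    (var .K 4))) (eq (.rho (.mulK (var .K 3) (var .K 4))) (.mulk (.rho (var .K 3)) (.rho
    (var .K 4))))))))).2 h.rho_mul
  rho_one := (H (eq (.rho (var .K 1)) (var .k 1))).2 h.rho_one
  rho_zero := (H (eq (.rho (var .K 0)) (var .k 0))).2 h.rho_zero
  rho_eq_zero := (H (all .K 3 (imp (not (eq (var .K 3) (var .K 0))) (imp (.leG (var .G 0) (.v
    (var .K 3))) (imp (eq (.rho (var .K 3)) (var .k 0)) (not (eq (.v (var .K 3)) (var .G 0)))))))).2
    h.rho_eq_zero
  rho_of_pos := (H (all .K 3 (imp (not (eq (var .K 3) (var .K 0))) (imp (.leG (var .G 0) (.v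
    (var .K 3))) (imp (not (eq (.v (var .K 3)) (var .G 0))) (eq (.rho (var .K 3)) (var .k 0))))))).2
    h.rho_of_pos
  iota_add := (H (all .k 3 (all .k 4 (eq (.iota (.addk (var .k 3) (var .k 4))) (.addK (.iota
    (var .k 3)) (.iota (var .k 4))))))).2 h.iota_add
  iota_mul := (H (all .k 3 (all .k 4 (eq (.iota (.mulk (var .k 3) (var .k 4))) (.mulK (.iota
    (var .k 3)) (.iota (var .k 4))))))).2 h.iota_mul
  iota_one := (H (eq (.iota (var .k 1)) (var .K 1))).2 h.iota_one
  iota_zero := (H (eq (.iota (var .k 0)) (var .K 0))).2 h.iota_zero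
  iota_mem := (H (all .k 3 (.leG (var .G 0) (.v (.iota (var .k 3)))))).2 h.iota_mem
  rho_iota := (H (all .k 3 (eq (.rho (.iota (var .k 3))) (var .k 3)))).2 h.rho_iota
  zero_mem := (H (memB (var .K 0))).2 h.zero_mem
  add_mem := (H (all .K 3 (all .K 4 (imp (memB (var .K 3)) (imp (memB (var .K 4)) (memB (.addK
    (var .K 3) (var .K 4)))))))).2 h.add_mem
  smul_mem := (H (all .k 3 (all .K 4 (imp (memB (var .K 4)) (memB (.mulK (.iota (var .k 3))
    (var .K 4))))))).2 h.smul_mem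
  mul_mem := (H (all .K 3 (all .K 4 (imp (memB (var .K 3)) (imp (memB (var .K 4)) (memB (.mulK
    (var .K 3) (var .K 4)))))))).2 h.mul_mem
  disjoint := (H (all .K 3 (imp (memB (var .K 3)) (imp (.leG (var .G 0) (.v (var .K 3))) (eq
    (var .K 3) (var .K 0)))))).2 h.disjoint
  t_mem := (H (all .G 3 (imp (.leG (var .G 3) (var .G 0)) (imp (not (eq (var .G 3) (var .G 0)))
    (memB (.t (var .G 3))))))).2 h.t_mem
  decomposition := (H (all .K 3 (all .G 4 (eq (var .K 3) (.addK (.addK (.h₁ (var .K 3) (var .G 4))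
    (.mulK (.iota (.g (var .K 3) (var .G 4))) (.t (var .G 4)))) (.h₂ (var .K 3) (var .G 4))))))).2
    h.decomposition
  h₁_mem := (H (all .K 3 (all .G 4 (all .G 5 (imp (eq (.addG (var .G 4) (var .G 5)) (var .G 0))
    (memB (.mulK (.t (var .G 5)) (.h₁ (var .K 3) (var .G 4))))))))).2 h.h₁_mem
  v_h₂ := (H (all .K 3 (all .G 4 (imp (not (eq (.h₂ (var .K 3) (var .G 4)) (var .K 0))) (.leG
    (var .G 4) (.v (.h₂ (var .K 3) (var .G 4)))))))).2 h.v_h₂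
  v_h₂_ne := (H (all .K 3 (all .G 4 (imp (not (eq (.h₂ (var .K 3) (var .G 4)) (var .K 0))) (not (eq
    (.v (.h₂ (var .K 3) (var .G 4))) (var .G 4))))))).2 h.v_h₂_ne
  g_c := (H (all .G 3 (imp (.leG (var .G 0) (var .G 3)) (eq (.g .c (var .G 3)) (var .k 1))))).2
    h.g_c
  g_c_of_neg := (H (all .G 3 (imp (.leG (var .G 3) (var .G 0)) (imp (not (eq (var .G 3) (var .G 0)))
    (eq (.g .c (var .G 3)) (var .k 0)))))).2 h.g_c_of_neg
  h₁_c := (H (all .G 3 (imp (.leG (var .G 0) (var .G 3)) (eq (.addK (.h₁ .c (var .G 3)) (.t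
    (var .G 3))) (.addK (.mulK (.h₁ .c (var .G 3)) (.t (var .G 1))) (var .K 1)))))).2 h.h₁_c

end transfer

end VStruct

/-- The values of the variables that serve as names for the constants in `VStruct.Laws`. -/
noncomputable def laurentConstants (F : Type u) [Field F] : (laurentStruct F).Assignment
  | .K, 0 => (0 : HahnSeries ℤ F)
  | .K, 1 => (1 : HahnSeries ℤ F)
  | .K, _ => (-1 : HahnSeries ℤ F)
  | .k, 0 => (0 : F)
  | .k, 1 => (1 : F)
  | .k, _ => (-1 : F)
  | .G, 0 => (⟨0⟩ : ULift.{u} ℤ)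
  | .G, _ => (⟨1⟩ : ULift.{u} ℤ)

/-- Needed because saturation only concerns types over finitely many parameters. -/
theorem finite_range_laurentConstants (F : Type u) [Field F] (s : Srt) :
    (Set.range (laurentConstants F s)).Finite := by
  refine (Set.toFinite (laurentConstants F s '' {0, 1, 2})).subset ?_
  rintro _ ⟨n, rfl⟩
  match n with
  | 0 => exact ⟨0, by simp, rfl⟩
  | 1 => exact ⟨1, by simp, rfl⟩
  | n + 2 => exact ⟨2, by simp, by cases s <;> rfl⟩

/-! ### Computations with Laurent series -/

namespace HahnSeries

variable {F : Type*} [Field F]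

theorem coeff_geometric (n : ℤ) :
    (ofPowerSeries ℤ F (PowerSeries.mk fun _ => (1 : F))).coeff n = if 0 ≤ n then 1 else 0 := by
  split_ifs with h
  · obtain ⟨m, rfl⟩ := Int.eq_ofNat_of_zero_le h
    exact (ofPowerSeries_apply_coeff _ m).trans (by simp)
  · rw [ofPowerSeries_apply, embDomain_of_notMem_range]
    rintro ⟨m, hm⟩
    simp only [Nat.castOrderEmbedding_apply] at hm
    omega

theorem coeff_eq_zero_of_neg {x : HahnSeries ℤ F} (hx : 0 ≤ x.order) {n : ℤ} (hn : n < 0) :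
    x.coeff n = 0 :=
  coeff_eq_zero_of_lt_order (hn.trans_le hx)

theorem order_add_nonneg {x y : HahnSeries ℤ F} (hx : 0 ≤ x.order) (hy : 0 ≤ y.order) :
    0 ≤ (x + y).order := by
  by_cases h : x + y = 0
  · simp [h]
  · exact (le_min hx hy).trans (min_order_le_order_add h)

theorem order_mul_nonneg {x y : HahnSeries ℤ F} (hx : 0 ≤ x.order) (hy : 0 ≤ y.order) :
    0 ≤ (x * y).order := by
  by_cases h₁ : x = 0
  · simp [h₁]
  by_cases h₂ : y = 0
  · simp [h₂]
  rw [order_mul h₁ h₂]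
  exact add_nonneg hx hy

theorem coeff_zero_mul {x y : HahnSeries ℤ F} (hx : 0 ≤ x.order) (hy : 0 ≤ y.order) :
    (x * y).coeff 0 = x.coeff 0 * y.coeff 0 := by
  rw [coeff_mul]
  have h : ∀ ij ∈ Finset.antidiagonal x.isPWO_support y.isPWO_support (0 : ℤ), ij = (0, 0) := by
    rintro ⟨i, j⟩ hij
    obtain ⟨hi, hj, hij⟩ := Finset.mem_antidiagonal.1 hij
    have hi := hx.trans (order_le_of_coeff_ne_zero hi)
    have hj := hy.trans (order_le_of_coeff_ne_zero hj)
    ext <;> simp only at * <;> omega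
  -- The antidiagonal is restricted to the supports, so it omits `(0, 0)` when a constant
  -- coefficient vanishes; both sides are then `0`.
  by_cases h0 : ((0 : ℤ), (0 : ℤ)) ∈ Finset.antidiagonal x.isPWO_support y.isPWO_support (0 : ℤ)
  · exact Finset.sum_eq_single_of_mem _ h0 fun b hb hne => absurd (h b hb) hne
  · rw [Finset.sum_eq_zero fun b hb => absurd (h b hb ▸ hb) h0]
    simp only [Finset.mem_antidiagonal, mem_support, add_zero, and_true, not_and_or,
      not_not] at h0
    obtain h0 | h0 := h0 <;> simp [h0]

theorem residue_add {x y : HahnSeries ℤ F} (hx : 0 ≤ x.order) (hy : 0 ≤ y.order) :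
    (if 0 ≤ (x + y).order then (x + y).coeff 0 else 0) =
      (if 0 ≤ x.order then x.coeff 0 else 0) + (if 0 ≤ y.order then y.coeff 0 else 0) := by
  rw [if_pos (order_add_nonneg hx hy), if_pos hx, if_pos hy, coeff_add]

theorem residue_mul {x y : HahnSeries ℤ F} (hx : 0 ≤ x.order) (hy : 0 ≤ y.order) :
    (if 0 ≤ (x * y).order then (x * y).coeff 0 else 0) =
      (if 0 ≤ x.order then x.coeff 0 else 0) * (if 0 ≤ y.order then y.coeff 0 else 0) := by
  rw [if_pos (order_mul_nonneg hx hy), if_pos hx, if_pos hy, coeff_zero_mul hx hy]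

theorem single_add_one (m n : ℤ) :
    single (m + n) (1 : F) = single m (1 : F) * single n (1 : F) := by
  rw [single_mul_single, mul_one]

theorem coeff_mul_single_one (x : HahnSeries ℤ F) (m n : ℤ) :
    (x * single m (1 : F)).coeff n = x.coeff (n - m) := by
  rw [coeff_mul_single, mul_one]

theorem lt_order_sub_truncLT {x : HahnSeries ℤ F} {m : ℤ} (h : x - truncLT (m + 1) x ≠ 0) :
    m < (x - truncLT (m + 1) x).order := by
  refine Int.lt_of_add_one_le ((le_order_iff_forall h).2 fun j hj => ?_)
  rw [coeff_sub, coeff_truncLT_of_lt hj, sub_self]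

theorem eq_truncLT_add_single_add (x : HahnSeries ℤ F) (m : ℤ) :
    x = truncLT m x + C (x.coeff m) * single m (1 : F) + (x - truncLT (m + 1) x) := by
  ext n
  simp only [coeff_add, coeff_sub, HahnSeries.coeff_truncLT, C_apply, single_mul_single, zero_add,
    mul_one, coeff_single]
  obtain h | rfl | h := lt_trichotomy n m
  · simp [h, h.ne, h.trans (lt_add_one m)]
  · simp
  · have h' : ¬ n < m + 1 := by omega
    simp [h.not_gt, h.ne', h']

/-- Both sides are `1 + t + ⋯ + t^m`. Since `m` is a variable of the value group sort, this is a
single first-order statement, and it survives for infinite `m` in an extension. -/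
theorem truncLT_geometric {m : ℤ} (hm : 0 ≤ m) :
    truncLT m (ofPowerSeries ℤ F (PowerSeries.mk fun _ => (1 : F))) + single m (1 : F) =
      truncLT m (ofPowerSeries ℤ F (PowerSeries.mk fun _ => (1 : F))) * single 1 (1 : F) + 1 := by
  ext n
  rw [coeff_add, coeff_add, coeff_mul_single_one]
  simp only [HahnSeries.coeff_truncLT, coeff_geometric, coeff_one, coeff_single]
  split_ifs <;> first | omega | simp

end HahnSeries

open HahnSeries in
theorem laurentStruct_laws (F : Type u) [Field F] :
    (laurentStruct F).Laws (laurentConstants F) where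
  addK_assoc := add_assoc (G := HahnSeries ℤ F)
  zero_addK := zero_add (M := HahnSeries ℤ F)
  neg_addK (x : HahnSeries ℤ F) := show -1 * x + x = 0 by ring
  mulK_assoc := mul_assoc (G := HahnSeries ℤ F)
  mulK_comm := mul_comm (G := HahnSeries ℤ F)
  one_mulK := one_mul (M := HahnSeries ℤ F)
  mulK_addK := mul_add (R := HahnSeries ℤ F)
  invK (x : HahnSeries ℤ F) hx := ⟨(x⁻¹ : HahnSeries ℤ F), mul_inv_cancel₀ (G₀ := HahnSeries ℤ F) hx⟩
  zero_ne_oneK := zero_ne_one (α := HahnSeries ℤ F)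
  addk_assoc := add_assoc (G := F)
  zero_addk := zero_add (M := F)
  neg_addk (x : F) := show -1 * x + x = 0 by ring
  mulk_assoc := mul_assoc (G := F)
  mulk_comm := mul_comm (G := F)
  one_mulk := one_mul (M := F)
  mulk_addk := mul_add (R := F)
  invk (x : F) hx := ⟨(x⁻¹ : F), mul_inv_cancel₀ (G₀ := F) hx⟩
  zero_ne_onek := zero_ne_one (α := F)
  addG_assoc := add_assoc (G := ULift.{u} ℤ)
  zero_addG := zero_add (M := ULift.{u} ℤ)
  addG_comm := add_comm (G := ULift.{u} ℤ)
  negG (x : ULift.{u} ℤ) := ⟨(-x : ULift.{u} ℤ), neg_add_cancel x⟩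
  le_refl (x : ULift.{u} ℤ) := le_refl x.down
  le_trans (x y z : ULift.{u} ℤ) := le_trans (a := x.down) (b := y.down) (c := z.down)
  le_antisymm (x y : ULift.{u} ℤ) h₁ h₂ := ULift.ext x y (le_antisymm h₁ h₂)
  le_total (x y : ULift.{u} ℤ) := le_total x.down y.down
  add_le_add (x y z : ULift.{u} ℤ) h := add_le_add_left (show x.down ≤ y.down from h) z.down
  zero_le_one := show (0 : ℤ) ≤ 1 by decide
  zero_ne_oneG := show (⟨0⟩ : ULift.{u} ℤ) ≠ ⟨1⟩ by simp
  v_zero := congrArg ULift.up (order_zero (R := F) (Γ := ℤ))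
  v_mul (x y : HahnSeries ℤ F) hx hy := congrArg ULift.up (order_mul hx hy)
  v_add (x y : HahnSeries ℤ F) _ _ h := min_le_iff.1 (min_order_le_order_add h)
  v_t (γ : ULift.{u} ℤ) := ULift.ext _ _ (order_single (one_ne_zero (α := F)))
  t_ne_zero (γ : ULift.{u} ℤ) := single_ne_zero (one_ne_zero (α := F))
  t_add (γ δ : ULift.{u} ℤ) := single_add_one (F := F) γ.down δ.down
  rho_add (x y : HahnSeries ℤ F) hx hy := residue_add (F := F) hx hy
  rho_mul (x y : HahnSeries ℤ F) hx hy := residue_mul (F := F) hx hy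
  rho_one := (if_pos (order_one (R := F) (Γ := ℤ)).ge).trans (coeff_single_same (0 : ℤ) (1 : F))
  rho_zero := (if_pos (order_zero (R := F) (Γ := ℤ)).ge).trans (coeff_zero (R := F) (a := (0 : ℤ)))
  rho_eq_zero (x : HahnSeries ℤ F) hx h₀ h h' := by
    have hord : x.order = 0 := congrArg ULift.down h'
    have h₁ : x.coeff 0 = (0 : F) := (if_pos h₀).symm.trans h
    rw [← hord] at h₁
    exact hx (coeff_order_eq_zero.1 h₁)
  rho_of_pos (x : HahnSeries ℤ F) hx h₀ h := by
    have h₁ : (0 : ℤ) ≤ x.order := h₀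
    have h₂ : (0 : ℤ) ≠ x.order := fun h' => h (ULift.ext _ _ h'.symm)
    exact (if_pos h₀).trans (coeff_eq_zero_of_lt_order (R := F) (lt_of_le_of_ne h₁ h₂))
  iota_add := map_add (C (Γ := ℤ) (R := F))
  iota_mul := map_mul (C (Γ := ℤ) (R := F))
  iota_one := map_one (C (Γ := ℤ) (R := F))
  iota_zero := map_zero (C (Γ := ℤ) (R := F))
  iota_mem (a : F) := (order_C (Γ := ℤ) (R := F) (r := a)).ge
  rho_iota (a : F) := (if_pos (order_C (Γ := ℤ) (R := F) (r := a)).ge).trans (coeff_single_same 0 a)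
  zero_mem n hn := absurd rfl hn
  add_mem (x y : HahnSeries ℤ F) hx hy n hn :=
    (support_add_subset x y hn).elim (hx n) (hy n)
  smul_mem (a : F) (x : HahnSeries ℤ F) hx n hn := by
    refine hx n fun h => hn ?_
    have : (C a * x).coeff n = a * x.coeff n := by simp
    exact this.trans ((congrArg (a * ·) h).trans (mul_zero a))
  mul_mem (x y : HahnSeries ℤ F) hx hy n hn := by
    obtain ⟨i, hi, j, hj, rfl⟩ := support_mul_subset (x := x) (y := y) hn
    exact add_neg (hx i hi) (hy j hj)
  disjoint (x : HahnSeries ℤ F) hx h := HahnSeries.ext (funext fun n => by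
    by_contra hn
    exact hn (coeff_eq_zero_of_neg (x := x) h (hx n hn)))
  t_mem (γ : ULift.{u} ℤ) h₁ h₂ n hn := by
    obtain rfl : n = γ.down := support_single_subset hn
    exact lt_of_le_of_ne h₁ fun h => h₂ (ULift.ext _ _ h)
  decomposition (x : HahnSeries ℤ F) (γ : ULift.{u} ℤ) := eq_truncLT_add_single_add x γ.down
  h₁_mem (x : HahnSeries ℤ F) (γ δ : ULift.{u} ℤ) h n hn := by
    have h : γ.down + δ.down = 0 := congrArg ULift.down h
    obtain ⟨i, hi, j, hj, rfl⟩ := support_mul_subset (x := single δ.down (1 : F))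
      (y := truncLT γ.down x) hn
    rw [support_truncLT] at hj
    have hi : i = δ.down := support_single_subset hi
    have hj := hj.2
    simp only
    omega
  v_h₂ (x : HahnSeries ℤ F) (γ : ULift.{u} ℤ) h := (lt_order_sub_truncLT (x := x) h).le
  v_h₂_ne (x : HahnSeries ℤ F) (γ : ULift.{u} ℤ) h h' :=
    (lt_order_sub_truncLT (x := x) h).ne' (congrArg ULift.down h')
  g_c (γ : ULift.{u} ℤ) h := (coeff_geometric (F := F) γ.down).trans (if_pos h)
  g_c_of_neg (γ : ULift.{u} ℤ) h₁ h₂ := (coeff_geometric (F := F) γ.down).trans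
    (if_neg fun h => h₂ (ULift.ext _ _ (le_antisymm h₁ h)))
  h₁_c (γ : ULift.{u} ℤ) h := truncLT_geometric (F := F) h

/-! ### The valued field of a model -/

namespace SectionedValuedField

variable {K k G : Type*} [Field K] [Field k] [AddCommGroup G] [LinearOrder G]
  [IsOrderedAddMonoid G]

theorem IsComplement.sub_mem {S : SectionedValuedField K k G} {A : Set K} (hA : S.IsComplement A)
    {x y : K} (hx : x ∈ A) (hy : y ∈ A) : x - y ∈ A := by
  have := hA.add_mem _ hx _ (hA.smul_mem (-1) y hy)
  rwa [map_neg, map_one, neg_one_mul, ← sub_eq_add_neg] at this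

theorem t_ne_zero (S : SectionedValuedField K k G) (γ : G) : S.t γ ≠ 0 := by
  intro h
  have := S.v_t γ
  rw [h, AddValuation.map_zero] at this
  exact WithTop.coe_ne_top this.symm

/-- The difference `t^γ (y - y')` of the lower parts has valuation at least `γ`, so `y - y'` lies in
both `A` and the valuation ring and vanishes. Then `(a - a') t^γ` has valuation above `γ`, so the
constant `a - a'` has residue `0`, hence is `0`. -/
theorem IsSplitting.unique {S : SectionedValuedField K k G} {A : Set K} (hA : S.IsComplement A)
    {x : K} {γ : G} {x₁ x₁' : K} {a a' : k} {x₂ x₂' : K} (h : S.IsSplitting A x γ x₁ a x₂)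
    (h' : S.IsSplitting A x γ x₁' a' x₂') : x₁ = x₁' ∧ a = a' ∧ x₂ = x₂' := by
  obtain ⟨⟨y, hy, rfl⟩, hv, hx⟩ := h
  obtain ⟨⟨y', hy', rfl⟩, hv', hx'⟩ := h'
  have hv₂ : (γ : WithTop G) < S.v (x₂' - x₂) :=
    (lt_min hv' hv).trans_le (AddValuation.map_sub S.v x₂' x₂)
  have hcancel : ∀ b : WithTop G, (γ : WithTop G) ≤ γ + b → 0 ≤ b := by
    intro b hb
    induction b with
    | top => exact le_top
    | coe b =>
      norm_cast at hb ⊢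
      simpa using hb
  have hvι : ∀ b : k, (γ : WithTop G) ≤ S.v (S.ι b * S.t γ) := fun b => by
    rw [AddValuation.map_mul, S.v_t]
    exact le_add_of_nonneg_left (S.ι_mem b)
  have hyy : y = y' := by
    have he : S.t γ * (y - y') = S.ι (a' - a) * S.t γ + (x₂' - x₂) := by
      rw [map_sub]
      linear_combination hx' - hx
    refine sub_eq_zero.1 (hA.disjoint _ (hA.sub_mem hy hy') (hcancel _ ?_))
    rw [← S.v_t γ, ← AddValuation.map_mul, he, S.v_t]
    exact (le_min (hvι _) hv₂.le).trans (AddValuation.map_add S.v _ _)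
  subst hyy
  have haa : a = a' := by
    have he : S.ι (a - a') * S.t γ = x₂' - x₂ := by
      rw [map_sub]
      linear_combination hx' - hx
    refine sub_eq_zero.1 ?_
    rw [← S.res_ι (a - a'), S.res_eq_zero_iff]
    rw [← he, AddValuation.map_mul, S.v_t] at hv₂
    refine lt_of_le_of_ne (S.ι_mem (a - a')) fun h0 => ?_
    rw [← h0, zero_add] at hv₂
    exact hv₂.false
  subst haa
  exact ⟨rfl, rfl, by linear_combination hx' - hx⟩

end SectionedValuedField

/-- Used twice: for `G^{≥0}`, and for the support of a supposed power series. -/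
theorem not_isWF_of_forall_sub_nsmul_mem {G : Type*} [AddCommGroup G] [LinearOrder G]
    [IsOrderedAddMonoid G] {s : Set G} {γ ε : G} (hε : 0 < ε) (hs : ∀ n : ℕ, γ - n • ε ∈ s) :
    ¬ s.IsWF := by
  rw [Set.isWF_iff_no_descending_seq]
  push Not
  refine ⟨fun n => γ - n • ε, ?_, fun n => hs n⟩
  exact fun m n hmn => sub_lt_sub_left (nsmul_lt_nsmul_left hε hmn) γ

namespace SectionedValuedField

variable {K k G : Type*} [Field K] [Field k] [AddCommGroup G] [LinearOrder G]
  [IsOrderedAddMonoid G]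

/-- If the quotient `y = (t ^ (-γ) - 1) / (1 - t ^ ε)` lies in `A` while `γ` exceeds all multiples
of `ε > 0`, then `A` does not come from a truncation closed embedding: the coefficients of `y` at
all negative multiples of `ε` would be `1`. -/
theorem not_isTruncationComplement {S : SectionedValuedField K k G} {A : Set K}
    (ht : ∀ α β, S.t (α + β) = S.t α * S.t β) {γ ε : G} (hε : 0 < ε) (hγ : ∀ n : ℕ, n • ε ≤ γ)
    {y : K} (hy : y ∈ A) (h : y + 1 = y * S.t ε + S.t (-γ)) : ¬ S.IsTruncationComplement A := by
  rintro ⟨f, hf, φ, hφ, rfl⟩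
  have hγ' : ∀ n : ℕ, n • ε < γ := fun n =>
    (nsmul_lt_nsmul_left hε (Nat.lt_succ_self n)).trans_le (hγ (n + 1))
  -- As `t` is a homomorphism, its factor set is trivial and the twisted product is the usual one.
  have hf1 : ∀ α β, f α β = 1 := by
    intro α β
    have := hf α β
    rw [← ht] at this
    refine S.ι.injective ?_
    rw [map_one]
    exact mul_right_cancel₀ (S.t_ne_zero (α + β)) (this.symm.trans (one_mul _).symm)
  have hφ1 : φ 1 = HahnSeries.single 0 1 := by rw [← hφ.map_ι, map_one]
  -- The coefficient at `δ` of the image of `y + 1 = y t^ε + t^(-γ)`: a recursion from `δ` down to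
  -- `δ - ε`.
  have hcoeff : ∀ δ, (φ y).coeff δ + (HahnSeries.single (0 : G) (1 : k)).coeff δ =
      (φ y).coeff (δ - ε) + (HahnSeries.single (-γ) (1 : k)).coeff δ := by
    intro δ
    have hmul : (φ (y * S.t ε)).coeff δ = (φ y).coeff (δ - ε) := by
      rw [hφ.map_mul, hφ.map_t, ← mul_one ((φ y).coeff (δ - ε)), ← HahnSeries.coeff_mul_single,
        HahnSeries.coeff_mul, twistedMulCoeff]
      simp only [hf1, one_mul]
    rw [← hφ1, ← hφ.map_t, ← hmul, ← HahnSeries.coeff_add, ← HahnSeries.coeff_add, ← hφ.map_add,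
      ← hφ.map_add, h]
  have hone : ∀ n : ℕ, (φ y).coeff (-ε - n • ε) = 1 := by
    intro n
    induction n with
    | zero =>
      -- Only here does membership of `y` in `A` enter: at `δ = 0` the summand `1` must be matched
      -- by the coefficient at `-ε`.
      have h0 : (φ y).coeff 0 = 0 := by
        by_contra h0
        exact (hy 0 h0).false
      have hne : (0 : G) ≠ -γ := by
        have := hγ' 0
        rw [zero_smul] at this
        exact (neg_lt_zero.2 this).ne'
      have := hcoeff 0
      rw [h0, HahnSeries.coeff_single_same, HahnSeries.coeff_single_of_ne hne] at this
      simpa using this.symm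
    | succ n ih =>
      -- The recursion never meets the monomial `t^(-γ)`, since `-γ` lies below all multiples of
      -- `-ε`.
      have hne : -ε - n • ε ≠ -γ := by
        have := hγ' (n + 1)
        rw [succ_nsmul'] at this
        rw [← neg_add', Ne, neg_inj]
        exact this.ne
      have hne0 : -ε - n • ε ≠ 0 := by
        rw [← neg_add', neg_ne_zero, ← succ_nsmul']
        exact (nsmul_pos hε n.succ_ne_zero).ne'
      have := hcoeff (-ε - n • ε)
      rw [ih, HahnSeries.coeff_single_of_ne hne0, HahnSeries.coeff_single_of_ne hne, add_zero,
        add_zero] at this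
      rw [this, succ_nsmul, sub_add_eq_sub_sub]
  refine not_isWF_of_forall_sub_nsmul_mem hε (s := (φ y).support) (γ := -ε) (fun n => ?_)
    (φ y).isWF_support
  rw [HahnSeries.mem_support, hone]
  exact one_ne_zero

end SectionedValuedField

/-! ### Algebraic structures on the sorts of a model -/

/-- A field structure on `α`, from its laws with `m` in place of `-1`. -/
noncomputable abbrev fieldOfLaws {α : Type*} (add mul : α → α → α) (z o m : α)
    (add_assoc : ∀ x y z, add (add x y) z = add x (add y z)) (zero_add : ∀ x, add z x = x)
    (neg_add : ∀ x, add (mul m x) x = z) (mul_assoc : ∀ x y z, mul (mul x y) z = mul x (mul y z))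
    (mul_comm : ∀ x y, mul x y = mul y x) (one_mul : ∀ x, mul o x = x)
    (mul_add : ∀ x y z, mul x (add y z) = add (mul x y) (mul x z))
    (inv : ∀ x, x ≠ z → ∃ y, mul x y = o) (zero_ne_one : z ≠ o) : Field α :=
  letI : DecidableEq α := Classical.decEq α
  letI : Add α := ⟨add⟩
  letI : Mul α := ⟨mul⟩
  letI : Zero α := ⟨z⟩
  letI : One α := ⟨o⟩
  letI : Neg α := ⟨mul m⟩
  letI : Inv α := ⟨fun x => if h : x = z then z else (inv x h).choose⟩
  Field.ofMinimalAxioms α add_assoc zero_add neg_add mul_assoc mul_comm one_mul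
    (fun x hx => by
      change mul x (dite _ _ _) = o
      rw [dif_neg (show ¬ x = z from hx)]
      exact (inv x hx).choose_spec)
    (dif_pos rfl) mul_add ⟨z, o, zero_ne_one⟩

namespace VStruct

variable {N : VStruct.{w}} {c : N.Assignment}

/-- The field structure on the first sort. -/
noncomputable abbrev Laws.fieldK (h : N.Laws c) : Field (N.carrier .K) :=
  fieldOfLaws N.addK N.mulK (c .K 0) (c .K 1) (c .K 2) h.addK_assoc h.zero_addK h.neg_addK
    h.mulK_assoc h.mulK_comm h.one_mulK h.mulK_addK h.invK h.zero_ne_oneK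

/-- The field structure on the residue field sort. -/
noncomputable abbrev Laws.fieldk (h : N.Laws c) : Field (N.carrier .k) :=
  fieldOfLaws N.addk N.mulk (c .k 0) (c .k 1) (c .k 2) h.addk_assoc h.zero_addk h.neg_addk
    h.mulk_assoc h.mulk_comm h.one_mulk h.mulk_addk h.invk h.zero_ne_onek

/-- The group structure on the value group sort. -/
noncomputable abbrev Laws.addCommGroupG (h : N.Laws c) : AddCommGroup (N.carrier .G) :=
  letI : Add (N.carrier .G) := ⟨N.addG⟩
  letI : Zero (N.carrier .G) := ⟨c .G 0⟩
  letI : Neg (N.carrier .G) := ⟨fun x => (h.negG x).choose⟩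
  { AddGroup.ofLeftAxioms h.addG_assoc h.zero_addG fun x => (h.negG x).choose_spec with
    add_comm := h.addG_comm }

/-- The ordering of the value group sort. -/
noncomputable abbrev Laws.linearOrderG (h : N.Laws c) : LinearOrder (N.carrier .G) where
  le := N.leG
  le_refl := h.le_refl
  le_trans := h.le_trans
  le_antisymm := h.le_antisymm
  le_total := h.le_total
  toDecidableLE := Classical.decRel _

/-- The operations of `N` and the constants named by `c` are those of the algebraic structures on
the sorts of `N`. -/
structure Interprets (N : VStruct.{w}) (c : N.Assignment) [Field (N.carrier .K)]
    [Field (N.carrier .k)] [AddCommGroup (N.carrier .G)] [LinearOrder (N.carrier .G)] : Prop where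
  addK : ∀ x y, N.addK x y = x + y
  mulK : ∀ x y, N.mulK x y = x * y
  zeroK : c .K 0 = 0
  oneK : c .K 1 = 1
  addk : ∀ x y, N.addk x y = x + y
  mulk : ∀ x y, N.mulk x y = x * y
  zerok : c .k 0 = 0
  onek : c .k 1 = 1
  addG : ∀ x y, N.addG x y = x + y
  zeroG : c .G 0 = 0
  leG : ∀ x y, N.leG x y ↔ x ≤ y

section

variable [Field (N.carrier .K)] [Field (N.carrier .k)] [AddCommGroup (N.carrier .G)]
  [LinearOrder (N.carrier .G)]

theorem Laws.zero_lt_one (h : N.Laws c) (i : N.Interprets c) : 0 < c .G 1 := by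
  have h1 := h.zero_le_one
  have h2 := h.zero_ne_oneG
  rw [i.leG] at h1
  rw [i.zeroG] at h1 h2
  exact lt_of_le_of_ne h1 h2

/-- The term `0 + 1 + ⋯ + 1`, where the variables `0` and `1` stand for the constants. -/
def numeral : ℕ → Term .G
  | 0 => .var .G 0
  | n + 1 => .addG (numeral n) (.var .G 1)

/-- Numerals mention only variables `0` and `1`, which leaves variable `2` free for the element to
be realised. -/
theorem Interprets.eval_numeral (i : N.Interprets c) (x : N.carrier .G) (n : ℕ) :
    N.eval (c.set .G 2 x) (numeral n) = n • c .G 1 := by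
  induction n with
  | zero =>
    rw [zero_smul, ← i.zeroG]
    exact Assignment.set_of_ne c (by decide) x
  | succ n ih =>
    rw [numeral, eval, ih, i.addG, succ_nsmul]
    exact congrArg _ (Assignment.set_of_ne c (by decide) x)

variable [IsOrderedAddMonoid (N.carrier .G)]

open Classical in
/-- The valuation of a model. -/
noncomputable def Laws.valuation (h : N.Laws c) (i : N.Interprets c) :
    AddValuation (N.carrier .K) (WithTop (N.carrier .G)) :=
  AddValuation.of (fun x => if x = 0 then ⊤ else (N.v x : WithTop (N.carrier .G)))
    (if_pos rfl)
    (by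
      -- `v 1 = v 1 + v 1` forces `v 1 = 0`.
      have h1 := h.v_mul 1 1 (by simp [i.zeroK]) (by simp [i.zeroK])
      rw [i.mulK, i.addG, one_mul] at h1
      rw [if_neg one_ne_zero, left_eq_add.1 h1]
      rfl)
    (by
      intro x y
      by_cases hx : x = 0
      · simp [hx]
      by_cases hy : y = 0
      · simp [hy]
      by_cases hxy : x + y = 0
      · simp [hxy]
      have := h.v_add x y (by rwa [i.zeroK]) (by rwa [i.zeroK]) (by rwa [i.zeroK, i.addK])
      rw [i.addK, i.leG, i.leG] at this
      simpa [hx, hy, hxy] using this)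
    (by
      intro x y
      by_cases hx : x = 0
      · simp [hx]
      by_cases hy : y = 0
      · simp [hy]
      have := h.v_mul x y (by rwa [i.zeroK]) (by rwa [i.zeroK])
      rw [i.mulK, i.addG] at this
      simp [hx, hy, this])

theorem Laws.valuation_of_ne_zero (h : N.Laws c) (i : N.Interprets c) {x : N.carrier .K}
    (hx : x ≠ 0) : h.valuation i x = (N.v x : WithTop (N.carrier .G)) :=
  if_neg hx

/-- At `x = 0` the valuation is `⊤` while `N.v` has the default value `0`; both are nonnegative, so
no exception is needed. -/
theorem Laws.valuation_nonneg_iff (h : N.Laws c) (i : N.Interprets c) {x : N.carrier .K} :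
    0 ≤ h.valuation i x ↔ N.leG (c .G 0) (N.v x) := by
  rw [i.leG, i.zeroG]
  by_cases hx : x = 0
  · have := h.v_zero
    rw [i.zeroK, i.zeroG] at this
    simp [hx, this]
  · rw [h.valuation_of_ne_zero i hx]
    norm_cast

/-- The valued field with sections given by a model. -/
noncomputable def Laws.sectionedValuedField (h : N.Laws c) (i : N.Interprets c) :
    SectionedValuedField (N.carrier .K) (N.carrier .k) (N.carrier .G) where
  v := h.valuation i
  v_surjective γ := by
    induction γ with
    | top => exact ⟨0, AddValuation.map_zero _⟩
    | coe γ =>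
      refine ⟨N.t γ, ?_⟩
      rw [h.valuation_of_ne_zero i (i.zeroK ▸ h.t_ne_zero γ), h.v_t]
  res :=
    { toFun := fun x => N.rho x
      map_one' := (congrArg N.rho i.oneK.symm).trans (h.rho_one.trans i.onek)
      map_zero' := (congrArg N.rho i.zeroK.symm).trans (h.rho_zero.trans i.zerok)
      map_add' := fun x y => by
        have := h.rho_add x y ((h.valuation_nonneg_iff i).1 x.2)
          ((h.valuation_nonneg_iff i).1 y.2)
        rwa [i.addK, i.addk] at this
      map_mul' := fun x y => by
        have := h.rho_mul x y ((h.valuation_nonneg_iff i).1 x.2)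
          ((h.valuation_nonneg_iff i).1 y.2)
        rwa [i.mulK, i.mulk] at this }
  res_surjective a :=
    ⟨⟨N.iota a, (h.valuation_nonneg_iff i).2 (h.iota_mem a)⟩, h.rho_iota a⟩
  res_eq_zero_iff := by
    rintro ⟨x, hx⟩
    have hx' := (h.valuation_nonneg_iff i).1 hx
    change N.rho x = 0 ↔ 0 < h.valuation i x
    by_cases h0 : x = 0
    · have := h.rho_zero
      rw [i.zeroK, i.zerok] at this
      simp [h0, this]
    have h1 := h.rho_eq_zero x (by rwa [i.zeroK]) hx'
    have h2 := h.rho_of_pos x (by rwa [i.zeroK]) hx'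
    rw [i.leG] at hx'
    rw [i.zerok, i.zeroG] at h1 h2
    rw [i.zeroG] at hx'
    rw [h.valuation_of_ne_zero i h0, ← WithTop.coe_zero, WithTop.coe_lt_coe]
    exact ⟨fun h3 => lt_of_le_of_ne hx' (h1 h3).symm, fun h3 => h2 h3.ne'⟩
  ι :=
    { toFun := N.iota
      map_one' := by simpa only [i.oneK, i.onek] using h.iota_one
      map_zero' := by simpa only [i.zeroK, i.zerok] using h.iota_zero
      map_add' := fun x y => by simpa only [i.addK, i.addk] using h.iota_add x y
      map_mul' := fun x y => by simpa only [i.mulK, i.mulk] using h.iota_mul x y }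
  ι_mem a := (h.valuation_nonneg_iff i).2 (h.iota_mem a)
  res_ι := h.rho_iota
  t := N.t
  v_t γ := by rw [h.valuation_of_ne_zero i (i.zeroK ▸ h.t_ne_zero γ), h.v_t]
  t_neg γ := by
    have ht : ∀ γ δ, N.t (γ + δ) = N.t γ * N.t δ := fun γ δ => by
      simpa only [i.addG, i.mulK] using h.t_add γ δ
    have hne : ∀ γ, N.t γ ≠ 0 := fun γ => i.zeroK ▸ h.t_ne_zero γ
    have h0 : N.t 0 = 1 := by
      have := ht 0 0
      rw [add_zero] at this
      exact (mul_eq_left₀ (hne 0)).1 this.symm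
    rw [eq_comm, inv_eq_iff_eq_inv, eq_comm, ← mul_eq_one_iff_inv_eq₀ (hne _), ← ht,
      neg_add_cancel, h0]

theorem Laws.presents (h : N.Laws c) (i : N.Interprets c) :
    N.Presents (h.sectionedValuedField i) where
  addK := i.addK
  mulK := i.mulK
  addG := i.addG
  leG := i.leG
  addk := i.addk
  mulk := i.mulk
  v _ hx := h.valuation_of_ne_zero i hx
  t _ := rfl
  rho _ := rfl
  iota _ := rfl

theorem Laws.t_add' (h : N.Laws c) (i : N.Interprets c) (α β : N.carrier .G) :
    (h.sectionedValuedField i).t (α + β) =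
      (h.sectionedValuedField i).t α * (h.sectionedValuedField i).t β := by
  have := h.t_add α β
  rwa [i.addG, i.mulK] at this

theorem Laws.isSplitting (h : N.Laws c) (i : N.Interprets c) (x : N.carrier .K)
    (γ : N.carrier .G) :
    (h.sectionedValuedField i).IsSplitting N.B x γ (N.h₁ x γ) (N.g x γ) (N.h₂ x γ) := by
  refine ⟨⟨N.t (-γ) * N.h₁ x γ, ?_, ?_⟩, ?_, ?_⟩
  -- The first-order law expresses membership in `t^γ B` as `t^δ x' ∈ B` for `γ + δ = 0`.
  · have := h.h₁_mem x γ (-γ) (by rw [i.addG, i.zeroG, add_neg_cancel])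
    rwa [i.mulK] at this
  · rw [← mul_assoc, show N.t (-γ) = (N.t γ)⁻¹ from (h.sectionedValuedField i).t_neg γ]
    exact (mul_inv_cancel_left₀ ((h.sectionedValuedField i).t_ne_zero γ) _).symm.trans
      (mul_assoc _ _ _).symm
  · change (γ : WithTop (N.carrier .G)) < h.valuation i (N.h₂ x γ)
    by_cases h0 : N.h₂ x γ = 0
    · simp [h0]
    have h1 := h.v_h₂ x γ (by rwa [i.zeroK])
    have h2 := h.v_h₂_ne x γ (by rwa [i.zeroK])
    rw [i.leG] at h1
    rw [h.valuation_of_ne_zero i h0, WithTop.coe_lt_coe]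
    exact lt_of_le_of_ne h1 h2.symm
  · have := h.decomposition x γ
    rwa [i.addK, i.addK, i.mulK] at this

theorem Laws.isComplement (h : N.Laws c) (i : N.Interprets c) :
    (h.sectionedValuedField i).IsComplement N.B where
  zero_mem := i.zeroK ▸ h.zero_mem
  add_mem x hx y hy := i.addK x y ▸ h.add_mem x y hx hy
  smul_mem a x hx := i.mulK _ x ▸ h.smul_mem a x hx
  disjoint x hx hv := i.zeroK ▸ h.disjoint x hx ((h.valuation_nonneg_iff i).1 hv)
  codisjoint x := by
    -- Splitting at `γ = 0` gives the sum: the part below lies in `B`, the rest in the valuation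
    -- ring.
    obtain ⟨⟨y, hy, h₁⟩, hv, hx⟩ := h.isSplitting i x 0
    have ht : (h.sectionedValuedField i).t 0 = 1 := by
      have := h.t_add' i 0 0
      rw [add_zero] at this
      exact (mul_eq_left₀ ((h.sectionedValuedField i).t_ne_zero 0)).1 this.symm
    rw [ht, one_mul] at h₁
    rw [ht, mul_one, add_assoc] at hx
    exact ⟨_, h₁ ▸ hy, _, Subring.add_mem _ ((h.sectionedValuedField i).ι_mem _)
      (le_of_lt (a := (0 : WithTop (N.carrier .G))) hv), hx⟩

theorem Laws.isSplitting_iff (h : N.Laws c) (i : N.Interprets c) (x : N.carrier .K)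
    (γ : N.carrier .G) (x₁ : N.carrier .K) (a : N.carrier .k) (x₂ : N.carrier .K) :
    (h.sectionedValuedField i).IsSplitting N.B x γ x₁ a x₂ ↔
      x₁ = N.h₁ x γ ∧ a = N.g x γ ∧ x₂ = N.h₂ x γ := by
  constructor
  · exact fun hs => hs.unique (h.isComplement i) (h.isSplitting i x γ)
  · rintro ⟨rfl, rfl, rfl⟩
    exact h.isSplitting i x γ

theorem Laws.supp_c (h : N.Laws c) (i : N.Interprets c) :
    (h.sectionedValuedField i).supp N.B N.c = Set.Ici 0 := by
  ext γ
  simp only [SectionedValuedField.supp, h.isSplitting_iff i, Set.mem_ofPred_eq, Set.mem_Ici]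
  constructor
  · rintro ⟨_, _, _, ⟨-, rfl, -⟩, hne⟩
    by_contra hγ
    refine hne ?_
    rw [← i.zerok]
    refine h.g_c_of_neg γ ?_ ?_
    · rw [i.leG, i.zeroG]
      exact (not_le.1 hγ).le
    · rw [i.zeroG]
      exact (not_le.1 hγ).ne
  · intro hγ
    refine ⟨_, _, _, ⟨rfl, rfl, rfl⟩, ?_⟩
    rw [h.g_c γ (by rwa [i.leG, i.zeroG]), i.onek]
    exact one_ne_zero

/-- Realise the type `{n • 1 ≤ x : n ∈ ℕ}`; finitely many of its conditions are met by a large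
enough multiple of `1`. -/
theorem IsOmegaSaturated.exists_forall_nsmul_le (hN : N.IsOmegaSaturated) (h : N.Laws c)
    (i : N.Interprets c) (hc : ∀ s, (Set.range (c s)).Finite) :
    ∃ γ, ∀ n : ℕ, n • c .G 1 ≤ γ := by
  have hsat : ∀ x n, N.Sat (c.set .G 2 x) (.leG (numeral n) (.var .G 2)) ↔ n • c .G 1 ≤ x := by
    intro x n
    rw [Sat, i.eval_numeral, i.leG, eval, Assignment.set_self]
  obtain ⟨γ, hγ⟩ := hN c hc .G 2 (Set.range fun n => .leG (numeral n) (.var .G 2)) (by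
    intro Φ hΦ
    have hb : ∃ m : ℕ, ∀ φ ∈ Φ, ∃ n ≤ m, Fml.leG (numeral n) (.var .G 2) = φ := by
      choose! r hr using fun φ (hφ : φ ∈ Φ) => hΦ hφ
      exact ⟨Φ.sup r, fun φ hφ => ⟨r φ, Finset.le_sup hφ, hr φ hφ⟩⟩
    obtain ⟨m, hm⟩ := hb
    refine ⟨m • c .G 1, fun φ hφ => ?_⟩
    obtain ⟨n, hn, rfl⟩ := hm φ hφ
    exact (hsat _ _).2 (nsmul_le_nsmul_left (h.zero_lt_one i).le hn))
  exact ⟨γ, fun n => (hsat γ n).1 (hγ _ ⟨n, rfl⟩)⟩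

theorem Laws.not_isTruncationComplement (h : N.Laws c) (i : N.Interprets c) {γ : N.carrier .G}
    (hγ : ∀ n : ℕ, n • c .G 1 ≤ γ) :
    ¬ (h.sectionedValuedField i).IsTruncationComplement N.B := by
  have hB := h.h₁_mem N.c γ (-γ) (by rw [i.addG, i.zeroG, add_neg_cancel])
  have hc := h.h₁_c γ (by
    rw [i.leG, i.zeroG]
    simpa using hγ 0)
  rw [i.addK, i.addK, i.mulK, i.oneK] at hc
  rw [i.mulK] at hB
  -- The witness is `y = t^(-γ) h'(c, γ)` with `ε = 1`; its equation is `t^(-γ)` times the geometric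
  -- sum law.
  refine SectionedValuedField.not_isTruncationComplement (h.t_add' i) (h.zero_lt_one i) hγ hB ?_
  have ht : N.t (-γ) * N.t γ = 1 := by
    rw [show N.t (-γ) = (N.t γ)⁻¹ from (h.sectionedValuedField i).t_neg γ]
    exact inv_mul_cancel₀ ((h.sectionedValuedField i).t_ne_zero γ)
  change _ = _ * N.t (c .G 1) + N.t (-γ)
  linear_combination N.t (-γ) * hc - ht

end

end VStruct

theorem mainTheorem12 (F : Type u) [Field F] :
    (∃ N : VStruct.{u}, (laurentStruct F).IsElementaryExtension N ∧ N.IsOmegaSaturated) ∧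
    ∀ N : VStruct.{w}, (laurentStruct F).IsElementaryExtension N → N.IsOmegaSaturated →
      ∃ (_ : Field (N.carrier .K)) (_ : Field (N.carrier .k)) (_ : AddCommGroup (N.carrier .G))
        (_ : LinearOrder (N.carrier .G)) (_ : IsOrderedAddMonoid (N.carrier .G))
        (S : SectionedValuedField (N.carrier .K) (N.carrier .k) (N.carrier .G)),
        N.Presents S ∧
        (∀ α β, S.t (α + β) = S.t α * S.t β) ∧
        S.IsComplement N.B ∧
        SectionedValuedField.IsMultiplicative N.B ∧
        S.IsCompatible N.B ∧
        (∀ x γ x₁ a x₂, S.IsSplitting N.B x γ x₁ a x₂ ↔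
          x₁ = N.h₁ x γ ∧ a = N.g x γ ∧ x₂ = N.h₂ x γ) ∧
        (∀ γ, 0 ≤ γ → N.g N.c γ = 1) ∧
        S.supp N.B N.c = Set.Ici 0 ∧
        ¬ (Set.Ici (0 : N.carrier .G)).IsWF ∧
        ¬ S.IsTruncationComplement N.B := by
  refine ⟨⟨_, VStruct.isElementaryExtension_ultrapower _ _,
    VStruct.isOmegaSaturated_ultrapower _⟩, ?_⟩
  rintro N ⟨e, he⟩ hN
  let c : N.Assignment := fun s n => e s (laurentConstants F s n)
  have h : N.Laws c := (laurentStruct_laws F).transfer fun φ => he φ _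
  have hc : ∀ s, (Set.range (c s)).Finite := fun s => by
    rw [show c s = e s ∘ laurentConstants F s from rfl, Set.range_comp]
    exact (finite_range_laurentConstants F s).image _
  let := h.fieldK
  let := h.fieldk
  let := h.addCommGroupG
  let := h.linearOrderG
  have : IsOrderedAddMonoid (N.carrier .G) :=
    { add_le_add_left := fun x y hxy z => h.add_le_add x y z hxy }
  have i : N.Interprets c :=
    { addK := fun _ _ => rfl
      mulK := fun _ _ => rfl
      zeroK := rfl
      oneK := rfl
      addk := fun _ _ => rfl
      mulk := fun _ _ => rfl
      zerok := rfl
      onek := rfl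
      addG := fun _ _ => rfl
      zeroG := rfl
      leG := fun _ _ => Iff.rfl }
  obtain ⟨γ, hγ⟩ := hN.exists_forall_nsmul_le h i hc
  refine ⟨‹_›, ‹_›, ‹_›, ‹_›, ‹_›, h.sectionedValuedField i, h.presents i, h.t_add' i,
    h.isComplement i, fun x hx y hy => h.mul_mem x y hx hy, fun γ hγ => h.t_mem γ hγ.le hγ.ne,
    h.isSplitting_iff i, h.g_c, h.supp_c i, ?_, h.not_isTruncationComplement i hγ⟩
  exact not_isWF_of_forall_sub_nsmul_mem (h.zero_lt_one i) fun n => sub_nonneg.2 (hγ n)
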